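/- Let $\Lambda>0$ and $0<v_0<1$. For $0\le\alpha<1$ and $c\ge 0$ consider, in the quadrant $Q=\{x\ge 0,\ y\le 0\}$, the vector field $$X_c:\qquad x'=y,\qquad y'=\frac1\Lambda\,(cy+x^\alpha).$$ The stable manifold of $X_c$ is the set of points $m\in Q\setminus\{(0,0)\}$ for which there are $\tau\in(0,+\infty]$ and a trajectory of $X_c$ on $[0,\tau)$ that starts at $m$, stays in $Q\setminus\{(0,0)\}$ and tends to the origin as $t\to\tau^-$; such a $\tau$ is called the settling time from $m$ to the origin. For every $0\le\alpha<1$ there is exactly one $c=c(v_0)\ge 0$ such that the point $\big(v_0,-\frac{c}{\Lambda}(1-v_0)\big)$ lies on the stable manifold of $X_c$. For this $c$ the settling time $R(v_0)$ from that point to the origin is uniquely determined and finite, and $$\frac{(2(1+\alpha)\Lambda)^{1/2}}{1-\alpha}\,v_0^{\frac{1-\alpha}{2}}\;<\;R(v_0)\;<\;\frac{2\Lambda^{1/2}A(\alpha)}{1-\alpha}\,\frac{v_0^{\frac{1-\alpha}{2}}}{1-v_0},\qquad A(\alpha)=\frac{2^{3/2}}{(1+\alpha)^{1/2}}.$$ Moreover,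 for fixed $\Lambda$ and $v_0$, both the lower and the upper bound tend to $+\infty$ as $\alpha\to1^-$. -/

import Mathlib

open Filter Topology

noncomputable section

/-- The closed quadrant `Q = {x ≥ 0, y ≤ 0}` of the plane. -/
def quadrantQ : Set (ℝ × ℝ) := {p | 0 ≤ p.1 ∧ p.2 ≤ 0}

/-- The vector field `X_c(x, y) = (y, (c y + x^α) / Λ)` on the quadrant `Q`. -/
def fieldX (Λ α c : ℝ) (p : ℝ × ℝ) : ℝ × ℝ := (p.2, (c * p.2 + p.1 ^ α) / Λ)

/-- `γ`, restricted to `[0, τ)` with `0 < τ ≤ ∞`, is a trajectory of `X_c` that starts at `m`,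
stays in `Q`, does not meet the origin before time `τ`, and tends to the origin as `t → τ⁻`.
(The values of `γ` outside `[0, τ)` play no role; at `t = 0` the derivative is one-sided.) -/
structure IsTrajectoryToOrigin (Λ α c : ℝ) (m : ℝ × ℝ) (τ : EReal) (γ : ℝ → ℝ × ℝ) : Prop where
  pos : 0 < τ
  init : γ 0 = m
  ode : ∀ t : ℝ, 0 ≤ t → (t : EReal) < τ →
    HasDerivWithinAt γ (fieldX Λ α c (γ t)) (Set.Ici 0) t
  mem_Q : ∀ t : ℝ, 0 ≤ t → (t : EReal) < τ → γ t ∈ quadrantQ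
  ne_zero : ∀ t : ℝ, 0 ≤ t → (t : EReal) < τ → γ t ≠ 0
  tends : ∀ U ∈ 𝓝 (0 : ℝ × ℝ), ∃ s : ℝ, 0 ≤ s ∧ (s : EReal) < τ ∧
    ∀ t : ℝ, s ≤ t → (t : EReal) < τ → γ t ∈ U

/-- `τ ∈ (0, ∞]` is the settling time from `m`: the time it takes to go from `m` to the origin
along a trajectory of `X_c` in `Q`. -/
def IsSettlingTime (Λ α c : ℝ) (m : ℝ × ℝ) (τ : EReal) : Prop :=
  ∃ γ : ℝ → ℝ × ℝ, IsTrajectoryToOrigin Λ α c m τ γ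

/-- The stable manifold of `X_c` at the origin in `Q` (without the origin itself): the points from
which a trajectory in `Q` converges to the origin, in finite or infinite time. -/
def stableManifold (Λ α c : ℝ) : Set (ℝ × ℝ) := {m | ∃ τ : EReal, IsSettlingTime Λ α c m τ}

/-- The initial point `(v₀, -(c/Λ)(1 - v₀))`. -/
def initialPoint (Λ c v₀ : ℝ) : ℝ × ℝ := (v₀, -(c / Λ) * (1 - v₀))

/-- `c ≥ 0` is an admissible speed `c(v₀)`: the initial point lies on the stable manifold
of `X_c`. -/
def IsSpeed (Λ α v₀ c : ℝ) : Prop := 0 ≤ c ∧ initialPoint Λ c v₀ ∈ stableManifold Λ α c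

/-- `A(α) = 2^{3/2} / (1 + α)^{1/2}`. -/
def constA (α : ℝ) : ℝ := (2 : ℝ) ^ (3 / 2 : ℝ) / (1 + α) ^ (1 / 2 : ℝ)

/-- `(2(1+α)Λ)^{1/2} / (1-α) · v₀^{(1-α)/2}`. -/
def lowerBoundR (Λ v₀ α : ℝ) : ℝ :=
  (2 * (1 + α) * Λ) ^ (1 / 2 : ℝ) / (1 - α) * v₀ ^ ((1 - α) / 2)

/-- `2 Λ^{1/2} A(α) / (1-α) · v₀^{(1-α)/2} / (1 - v₀)`. -/
def upperBoundR (Λ v₀ α : ℝ) : ℝ :=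
  2 * Λ ^ (1 / 2 : ℝ) * constA α / (1 - α) * (v₀ ^ ((1 - α) / 2) / (1 - v₀))

end

/-! The energy y² - (2/(Λ(1+α))) x^(1+α) increases along a trajectory when c > 0 and tends to 0,
which bounds |y| above by a multiple of x^((1+α)/2). For small k the curve y² = k² x^(1+α) is a
barrier that bounds |y| below in the same way. Since x' = y, these two estimates bound the speed at
which x^((1-α)/2) decreases between two constants, so integrating over [0, R) gives both bounds on
the settling time (`rpow_fst_lt_mul_time`, `mul_time_lt_rpow_fst`). The upper bound needs no formula
for c: the energy estimate at the initial point controls c(1 - v₀).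

Uniqueness of the settling time: x decreases strictly, so before any time short of settling the
trajectory stays where x is bounded away from 0 and the field is Lipschitz. Uniqueness of the speed:
|y| on the stable manifold above a given x does not increase with c (`snd_le_of_speed_lt`), while
|y| at the prescribed initial point strictly increases with c.

Existence rests on the scaling x ↦ l x with a matching change of time, which turns a single orbit
for unit speed into orbits for every c > 0. That orbit, reversed in time, solves Λ X'' + X' = X^α
from rest at 0. The field is not Lipschitz there when α > 0, and X = 0 is then a solution too, so a
positive solution is obtained by monotone iteration between two power functions
(`exists_volterra_fixedPoint`). Its logarithmic derivative X'/X takes every positive value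
(`exists_deriv_eq_mul`), and prescribing this ratio places the initial point on the scaled orbit. -/

open Set

/-! ### Monotonicity from one-sided derivatives -/

/-- A function with positive derivative takes positive values right after a zero. -/
lemma exists_pos_right_of_hasDerivWithinAt {f : ℝ → ℝ} {f' t b : ℝ} (ht : 0 ≤ t) (htb : t < b)
    (hf : HasDerivWithinAt f f' (Ici 0) t) (h0 : f t = 0) (hf' : 0 < f') :
    ∃ s, t < s ∧ s < b ∧ 0 < f s := by
  have h1 : HasDerivWithinAt f f' (Ioi t) t :=
    hf.mono fun s hs => ht.trans (le_of_lt hs)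
  rw [hasDerivWithinAt_iff_tendsto_slope' (by simp)] at h1
  have h2 : ∀ᶠ s in 𝓝[>] t, 0 < slope f t s := h1.eventually (lt_mem_nhds hf')
  have h3 : ∀ᶠ s in 𝓝[>] t, s ∈ Ioo t b := Ioo_mem_nhdsGT htb
  obtain ⟨s, hs, hs1, hs2⟩ := (h2.and h3).exists
  refine ⟨s, hs1, hs2, ?_⟩
  rw [slope_def_field, h0, sub_zero] at hs
  have := sub_pos.2 hs1
  exact (div_pos_iff_of_pos_right this).1 hs

lemma lt_of_hasDerivWithinAt_pos {f f' : ℝ → ℝ} {a b : ℝ} (ha : 0 ≤ a) (hab : a < b)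
    (hf : ∀ t ∈ Icc a b, HasDerivWithinAt f (f' t) (Ici 0) t) (hpos : ∀ t ∈ Ioo a b, 0 < f' t) :
    f a < f b := by
  have hsub : Icc a b ⊆ Ici 0 := fun t ht => ha.trans ht.1
  refine strictMonoOn_of_deriv_pos (convex_Icc a b)
    (fun t ht => ((hf t ht).continuousWithinAt).mono hsub) (fun t ht => ?_)
    (left_mem_Icc.2 hab.le) (right_mem_Icc.2 hab.le) hab
  rw [interior_Icc] at ht
  have := (hf t (Ioo_subset_Icc_self ht)).hasDerivAt (Ici_mem_nhds (ha.trans_lt ht.1))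
  rw [this.deriv]
  exact hpos t ht

/-- A function that decreases wherever it is negative stays below a negative initial value. -/
lemma le_of_hasDerivWithinAt_neg_of_neg {f f' : ℝ → ℝ} {a b : ℝ} (hab : a ≤ b)
    (hc : ContinuousOn f (Icc a b))
    (hf : ∀ t ∈ Ico a b, HasDerivWithinAt f (f' t) (Ici t) t)
    (hneg : ∀ t ∈ Ico a b, f t < 0 → f' t < 0) (h0 : f a < 0) : f b ≤ f a := by
  refine image_le_of_deriv_right_lt_deriv_boundary (B := fun _ => f a) (B' := fun _ => 0) hc hf
    le_rfl (fun x => hasDerivAt_const x (f a)) (fun x hx hfx => hneg x hx (by rw [hfx]; exact h0))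
    (right_mem_Icc.2 hab)

lemma EReal.exists_coe_lt {t : ℝ} {τ : EReal} (htτ : (t : EReal) < τ) :
    ∃ b : ℝ, t < b ∧ (b : EReal) < τ := by
  obtain ⟨b, hb, hbτ⟩ := EReal.lt_iff_exists_real_btwn.1 htτ
  exact ⟨b, EReal.coe_lt_coe_iff.1 hb, hbτ⟩

lemma EReal.coe_lt_of_le {s t : ℝ} {τ : EReal} (hst : s ≤ t) (htτ : (t : EReal) < τ) :
    (s : EReal) < τ :=
  (EReal.coe_le_coe_iff.2 hst).trans_lt htτ

/-! ### Geometry of trajectories, slope estimates and time estimates -/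

namespace IsTrajectoryToOrigin

variable {Λ α c : ℝ} {m : ℝ × ℝ} {τ : EReal} {γ : ℝ → ℝ × ℝ}

lemma hasDeriv_fst (h : IsTrajectoryToOrigin Λ α c m τ γ) {t : ℝ} (ht : 0 ≤ t)
    (htτ : (t : EReal) < τ) :
    HasDerivWithinAt (fun t => (γ t).1) (γ t).2 (Ici 0) t :=
  (h.ode t ht htτ).fst

lemma hasDeriv_snd (h : IsTrajectoryToOrigin Λ α c m τ γ) {t : ℝ} (ht : 0 ≤ t)
    (htτ : (t : EReal) < τ) :
    HasDerivWithinAt (fun t => (γ t).2) ((c * (γ t).2 + (γ t).1 ^ α) / Λ) (Ici 0) t :=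
  (h.ode t ht htτ).snd

/-- On the negative y-axis x' = y < 0, so the trajectory would leave Q at once. -/
lemma fst_pos (h : IsTrajectoryToOrigin Λ α c m τ γ) {t : ℝ} (ht : 0 ≤ t)
    (htτ : (t : EReal) < τ) : 0 < (γ t).1 := by
  obtain ⟨hx, hy⟩ := h.mem_Q t ht htτ
  refine lt_of_le_of_ne hx fun h0 => ?_
  have hy' : (γ t).2 < 0 := lt_of_le_of_ne hy fun h1 => h.ne_zero t ht htτ (Prod.ext h0.symm h1)
  obtain ⟨b, hb, hbτ⟩ := EReal.lt_iff_exists_real_btwn.1 htτ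
  obtain ⟨s, hs, hsb, hpos⟩ := exists_pos_right_of_hasDerivWithinAt ht (EReal.coe_lt_coe_iff.1 hb)
    (h.hasDeriv_fst ht htτ).neg (by simp [← h0]) (by linarith : (0:ℝ) < -(γ t).2)
  have := (h.mem_Q s (ht.trans hs.le) ((EReal.coe_lt_coe_iff.2 hsb).trans hbτ)).1
  simp only [Pi.neg_apply] at hpos
  linarith

/-- On the positive x-axis y' = x^α / Λ > 0, so the trajectory would leave Q at once. -/
lemma snd_neg (hΛ : 0 < Λ) (h : IsTrajectoryToOrigin Λ α c m τ γ) {t : ℝ} (ht : 0 ≤ t)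
    (htτ : (t : EReal) < τ) : (γ t).2 < 0 := by
  obtain ⟨hx, hy⟩ := h.mem_Q t ht htτ
  refine lt_of_le_of_ne hy fun h0 => ?_
  have hx' := h.fst_pos ht htτ
  obtain ⟨b, hb, hbτ⟩ := EReal.lt_iff_exists_real_btwn.1 htτ
  obtain ⟨s, hs, hsb, hpos⟩ := exists_pos_right_of_hasDerivWithinAt ht (EReal.coe_lt_coe_iff.1 hb)
    (h.hasDeriv_snd ht htτ) h0
    (by rw [h0, mul_zero, zero_add]; have := Real.rpow_pos_of_pos hx' α; positivity)
  have := (h.mem_Q s (ht.trans hs.le) ((EReal.coe_lt_coe_iff.2 hsb).trans hbτ)).2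
  linarith

lemma exists_small (h : IsTrajectoryToOrigin Λ α c m τ γ) {ε t₀ : ℝ} (hε : 0 < ε)
    (htτ : (t₀ : EReal) < τ) :
    ∃ t, t₀ ≤ t ∧ (t : EReal) < τ ∧ (γ t).1 < ε ∧ -ε < (γ t).2 := by
  obtain ⟨s, -, hs1, hs2⟩ := h.tends _ (Metric.ball_mem_nhds 0 hε)
  have hlt : ((max s t₀ : ℝ) : EReal) < τ := by
    rcases max_choice s t₀ with h1 | h1 <;> rw [h1] <;> assumption
  have := hs2 (max s t₀) (le_max_left _ _) hlt
  rw [mem_ball_zero_iff, Prod.norm_def, max_lt_iff, Real.norm_eq_abs, Real.norm_eq_abs, abs_lt,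
    abs_lt] at this
  exact ⟨_, le_max_right _ _, hlt, this.1.2, this.2.1⟩

lemma fst_strictAnti (hΛ : 0 < Λ) (h : IsTrajectoryToOrigin Λ α c m τ γ) {s t : ℝ} (hs : 0 ≤ s)
    (hst : s < t) (htτ : (t : EReal) < τ) : (γ t).1 < (γ s).1 := by
  have := lt_of_hasDerivWithinAt_pos hs hst
    (fun r hr => (h.hasDeriv_fst (hs.trans hr.1) (EReal.coe_lt_of_le hr.2 htτ)).neg)
    (fun r hr => neg_pos.2 (h.snd_neg hΛ (hs.trans hr.1.le) (EReal.coe_lt_of_le hr.2.le htτ)))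
  simp only [Pi.neg_apply] at this
  linarith

lemma fst_le (hΛ : 0 < Λ) (h : IsTrajectoryToOrigin Λ α c m τ γ) {t : ℝ} (ht : 0 ≤ t)
    (htτ : (t : EReal) < τ) : (γ t).1 ≤ m.1 := by
  rcases ht.eq_or_lt with rfl | ht'
  · rw [h.init]
  · rw [← h.init]; exact (h.fst_strictAnti hΛ le_rfl ht' htτ).le

/-- The energy bound on the stable manifold. -/
lemma sq_snd_lt (hΛ : 0 < Λ) (hα : 0 ≤ α) (hc : 0 < c) (h : IsTrajectoryToOrigin Λ α c m τ γ)
    {t : ℝ} (ht : 0 ≤ t) (htτ : (t : EReal) < τ) :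
    (γ t).2 ^ 2 < 2 / (Λ * (1 + α)) * (γ t).1 ^ (1 + α) := by
  set E : ℝ → ℝ := fun t => (γ t).2 ^ 2 - 2 / (Λ * (1 + α)) * (γ t).1 ^ (1 + α) with hE
  -- The powers of x cancel in E', leaving 2 c y² / Λ > 0. As E tends to 0 at the origin, it must be
  -- negative throughout.
  have hmono : ∀ a b : ℝ, 0 ≤ a → a < b → (b : EReal) < τ → E a < E b := by
    intro a b ha hab hb
    refine lt_of_hasDerivWithinAt_pos (f' := fun t => 2 * c * (γ t).2 ^ 2 / Λ) ha hab ?_ ?_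
    · intro r hr
      have hr0 := ha.trans hr.1
      have hrτ := EReal.coe_lt_of_le hr.2 hb
      have hx := h.fst_pos hr0 hrτ
      refine (((h.hasDeriv_snd hr0 hrτ).pow 2).sub
        (((h.hasDeriv_fst hr0 hrτ).rpow_const (p := 1 + α) (.inl hx.ne')).const_mul
          (2 / (Λ * (1 + α))))).congr_deriv ?_
      rw [show 1 + α - 1 = α by ring]
      have : 1 + α ≠ 0 := by linarith
      simp only [Nat.cast_ofNat]
      field_simp
      ring
    · intro r hr
      have hy := h.snd_neg hΛ (ha.trans hr.1.le) (EReal.coe_lt_of_le hr.2.le hb)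
      have := sq_pos_of_neg hy
      positivity
  by_contra hcon
  have h0 : 0 ≤ E t := by simp only [hE]; linarith
  obtain ⟨b, htb, hb⟩ := EReal.exists_coe_lt htτ
  have hEb : 0 < E b := h0.trans_lt (hmono t b ht htb hb)
  obtain ⟨s, hbs, hs, -, hy⟩ := h.exists_small (Real.sqrt_pos.2 hEb) hb
  have hEs : E b ≤ E s := by
    rcases hbs.eq_or_lt with rfl | hbs
    · exact le_rfl
    · exact (hmono b s (ht.trans htb.le) hbs hs).le
  have hs0 : 0 ≤ s := (ht.trans htb.le).trans hbs
  have hx := Real.rpow_pos_of_pos (h.fst_pos hs0 hs) (1 + α)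
  have hys := h.snd_neg hΛ hs0 hs
  have h2 : (γ s).2 ^ 2 < E b := by
    rw [← Real.sq_sqrt hEb.le]; exact sq_lt_sq' (by linarith) (by linarith [Real.sqrt_nonneg (E b)])
  have h3 : E s ≤ (γ s).2 ^ 2 := by
    simp only [hE]
    have : 0 ≤ 2 / (Λ * (1 + α)) * (γ s).1 ^ (1 + α) := by positivity
    linarith
  linarith

/-- The curve `y² = k² x ^ (1 + α)` is a barrier below the stable manifold. -/
lemma lt_sq_snd (hΛ : 0 < Λ) (hα : 0 ≤ α) (hα1 : α < 1) (hc : 0 ≤ c) {k : ℝ} (hk : 0 < k)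
    (h : IsTrajectoryToOrigin Λ α c m τ γ)
    (hkm : k ^ 2 * (1 + α) * Λ / 2 + c * k * m.1 ^ ((1 - α) / 2) < 1)
    {t : ℝ} (ht : 0 ≤ t) (htτ : (t : EReal) < τ) :
    k ^ 2 * (γ t).1 ^ (1 + α) < (γ t).2 ^ 2 := by
  set F : ℝ → ℝ := fun t => (γ t).2 ^ 2 - k ^ 2 * (γ t).1 ^ (1 + α) with hF
  set F' : ℝ → ℝ := fun t => (γ t).2 *
    (2 * (c * (γ t).2 + (γ t).1 ^ α) / Λ - k ^ 2 * (1 + α) * (γ t).1 ^ α) with hF'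
  have hderiv : ∀ r : ℝ, 0 ≤ r → (r : EReal) < τ → HasDerivWithinAt F (F' r) (Ici 0) r := by
    intro r hr0 hrτ
    have hx := h.fst_pos hr0 hrτ
    refine (((h.hasDeriv_snd hr0 hrτ).pow 2).sub
      (((h.hasDeriv_fst hr0 hrτ).rpow_const (p := 1 + α) (.inl hx.ne')).const_mul
        (k ^ 2))).congr_deriv ?_
    rw [show 1 + α - 1 = α by ring]
    simp only [Nat.cast_ofNat, hF']
    field_simp
    ring
  -- Where F ≤ 0, |y| ≤ k x^α x^((1-α)/2), so all terms of the second factor of F' compare with x^α,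
  -- and `hkm` makes that factor positive. As y < 0, F decreases, and a trajectory past the barrier
  -- cannot reach the origin, where F vanishes.
  have hneg : ∀ r : ℝ, 0 ≤ r → (r : EReal) < τ → F r ≤ 0 → F' r < 0 := by
    intro r hr0 hrτ hFr
    have hx := h.fst_pos hr0 hrτ
    have hy := h.snd_neg hΛ hr0 hrτ
    have hxm := h.fst_le hΛ hr0 hrτ
    refine mul_neg_of_neg_of_pos hy ?_
    set x := (γ r).1
    set y := (γ r).2
    have hxα : 0 < x ^ α := Real.rpow_pos_of_pos hx α
    have hq : x ^ ((1 - α) / 2) ≤ m.1 ^ ((1 - α) / 2) :=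
      Real.rpow_le_rpow hx.le hxm (by linarith)
    have hyk : -y ≤ k * (x ^ α * x ^ ((1 - α) / 2)) := by
      refine abs_le_of_sq_le_sq' (a := -y) ?_ (by positivity) |>.2
      have h1 : (x ^ α * x ^ ((1 - α) / 2)) ^ 2 = x ^ (1 + α) := by
        rw [← Real.rpow_add hx, ← Real.rpow_natCast, ← Real.rpow_mul hx.le]
        congr 1; push_cast; ring
      rw [mul_pow, h1]
      simp only [hF] at hFr
      linarith
    have h2 : c * -y ≤ c * (k * (x ^ α * m.1 ^ ((1 - α) / 2))) :=
      mul_le_mul_of_nonneg_left (hyk.trans (by gcongr)) hc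
    have h3 : 0 < x ^ α * (1 - (k ^ 2 * (1 + α) * Λ / 2 + c * k * m.1 ^ ((1 - α) / 2))) :=
      mul_pos hxα (by linarith)
    have h4 : 2 * (c * y + x ^ α) / Λ - k ^ 2 * (1 + α) * x ^ α =
      2 / Λ * (c * y + x ^ α - k ^ 2 * (1 + α) * Λ / 2 * x ^ α) := by field_simp
    rw [h4]
    refine mul_pos (by positivity) ?_
    nlinarith
  by_contra hcon
  have h0 : F t ≤ 0 := by simp only [hF]; linarith
  -- If F vanishes at t, its strictly negative derivative makes it negative just after t.
  obtain ⟨b, htb, hb, hFb⟩ : ∃ b, t < b ∧ (b : EReal) < τ ∧ F b < 0 := by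
    rcases h0.lt_or_eq with h1 | h1
    · obtain ⟨b, htb, hb⟩ := EReal.exists_coe_lt htτ
      refine ⟨b, htb, hb, lt_of_le_of_lt (le_of_hasDerivWithinAt_neg_of_neg (f' := F') htb.le ?_ ?_ ?_ h1) h1⟩
      · exact fun r hr => ((hderiv r (ht.trans hr.1) (EReal.coe_lt_of_le hr.2 hb)).continuousWithinAt).mono
          fun s hs => ht.trans hs.1
      · exact fun r hr => (hderiv r (ht.trans hr.1) (EReal.coe_lt_of_le hr.2.le hb)).mono
          fun s hs => (ht.trans hr.1).trans hs
      · exact fun r hr hr' => hneg r (ht.trans hr.1) (EReal.coe_lt_of_le hr.2.le hb) hr'.le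
    · obtain ⟨b, htb, hb⟩ := EReal.exists_coe_lt htτ
      obtain ⟨s, hs, hsb, hpos⟩ := exists_pos_right_of_hasDerivWithinAt ht htb
        (hderiv t ht htτ).neg (by simp [h1]) (neg_pos.2 (hneg t ht htτ h0))
      exact ⟨s, hs, EReal.coe_lt_of_le hsb.le hb, neg_pos.1 hpos⟩
  have hb0 : 0 ≤ b := ht.trans htb.le
  have hε : 0 < min 1 (-F b / k ^ 2) := lt_min one_pos (div_pos (neg_pos.2 hFb) (by positivity))
  obtain ⟨s, hbs, hs, hxs, -⟩ := h.exists_small hε hb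
  have hs0 := hb0.trans hbs
  have hFs : F s ≤ F b := by
    refine le_of_hasDerivWithinAt_neg_of_neg (f' := F') hbs ?_ ?_ ?_ hFb
    · exact fun r hr => ((hderiv r (hb0.trans hr.1) (EReal.coe_lt_of_le hr.2 hs)).continuousWithinAt).mono
        fun s hs => hb0.trans hs.1
    · exact fun r hr => (hderiv r (hb0.trans hr.1) (EReal.coe_lt_of_le hr.2.le hs)).mono
        fun s hs => (hb0.trans hr.1).trans hs
    · exact fun r hr hr' => hneg r (hb0.trans hr.1) (EReal.coe_lt_of_le hr.2.le hs) hr'.le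
  have hx := h.fst_pos hs0 hs
  have h1 : (γ s).1 ^ (1 + α) ≤ (γ s).1 := by
    simpa using Real.rpow_le_rpow_of_exponent_ge hx (hxs.le.trans (min_le_left _ _))
      (by linarith : (1:ℝ) ≤ 1 + α)
  have h2 : (γ s).1 < -F b / k ^ 2 := hxs.trans_le (min_le_right _ _)
  rw [lt_div_iff₀ (by positivity)] at h2
  have h3 : k ^ 2 * (γ s).1 ^ (1 + α) ≤ k ^ 2 * (γ s).1 := by gcongr
  have h4 : -(k ^ 2 * (γ s).1 ^ (1 + α)) ≤ F s := by simp only [hF]; linarith [sq_nonneg (γ s).2]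
  linarith

/-- The exponent (1-α)/2 is chosen so that a bound of |y| by a multiple of x^((1+α)/2) makes this
derivative comparable with a constant. -/
lemma hasDeriv_rpow_fst (h : IsTrajectoryToOrigin Λ α c m τ γ) {t : ℝ} (ht : 0 ≤ t)
    (htτ : (t : EReal) < τ) :
    HasDerivWithinAt (fun t => (γ t).1 ^ ((1 - α) / 2))
      ((1 - α) / 2 * ((γ t).2 * (γ t).1 ^ (-((1 + α) / 2)))) (Ici 0) t := by
  refine ((h.hasDeriv_fst ht htτ).rpow_const (p := (1 - α) / 2)
    (.inl (h.fst_pos ht htτ).ne')).congr_deriv ?_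
  rw [show (1 - α) / 2 - 1 = -((1 + α) / 2) by ring]
  ring

/-- An upper bound on the slope of the stable manifold bounds the settling time from below. -/
lemma rpow_fst_lt_mul_time (hα1 : α < 1) {R C : ℝ} (hC : 0 < C)
    (h : IsTrajectoryToOrigin Λ α c m (R : EReal) γ)
    (hb : ∀ t : ℝ, 0 ≤ t → (t : EReal) < R → (γ t).2 ^ 2 < C ^ 2 * (γ t).1 ^ (1 + α)) :
    m.1 ^ ((1 - α) / 2) < (1 - α) / 2 * C * R := by
  set z : ℝ → ℝ := fun t => (γ t).1 ^ ((1 - α) / 2) + (1 - α) / 2 * C * t with hz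
  have hq : 0 < (1 - α) / 2 := by linarith
  have hmono : ∀ a b : ℝ, 0 ≤ a → a < b → (b : EReal) < R → z a < z b := by
    intro a b ha hab hbR
    refine lt_of_hasDerivWithinAt_pos ha hab (fun t ht =>
      (h.hasDeriv_rpow_fst (ha.trans ht.1) (EReal.coe_lt_of_le ht.2 hbR)).add
        ((hasDerivWithinAt_id t (Ici 0)).const_mul ((1 - α) / 2 * C))) fun t ht => ?_
    have ht0 := ha.trans ht.1.le
    have htR := EReal.coe_lt_of_le ht.2.le hbR
    have hx := h.fst_pos ht0 htR
    have hp : 0 < (γ t).1 ^ ((1 + α) / 2) := Real.rpow_pos_of_pos hx _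
    have h1 : -(C * (γ t).1 ^ ((1 + α) / 2)) < (γ t).2 := by
      refine (abs_lt_of_sq_lt_sq' ?_ (by positivity)).1
      rw [mul_pow, ← Real.rpow_mul_natCast hx.le]
      simpa using hb t ht0 htR
    rw [Real.rpow_neg hx.le, ← div_eq_mul_inv]
    have h2 : -C < (γ t).2 / (γ t).1 ^ ((1 + α) / 2) := by
      rw [lt_div_iff₀ hp]; linarith
    nlinarith
  have hR : (0 : ℝ) < R := EReal.coe_pos.1 h.pos
  -- The gain up to R/2 keeps the inequality strict when passing to the limit t → R.
  have h1 : z 0 < z (R / 2) := hmono 0 (R / 2) le_rfl (by positivity)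
    (by exact_mod_cast half_lt_self hR)
  have hz0 : z 0 = m.1 ^ ((1 - α) / 2) := by simp [hz, h.init]
  rw [hz0] at h1
  by_contra hcon
  push Not at hcon
  have hδ : 0 < z (R / 2) - (1 - α) / 2 * C * R := by linarith
  obtain ⟨s, hs, hsR, hxs, -⟩ := h.exists_small (Real.rpow_pos_of_pos hδ (1 / ((1 - α) / 2))) (by exact_mod_cast half_lt_self hR)
  have h2 : z (R / 2) ≤ z s := by
    rcases hs.eq_or_lt with rfl | hs
    · exact le_rfl
    · exact (hmono _ s (by positivity) hs hsR).le
  have h3 : (γ s).1 ^ ((1 - α) / 2) < z (R / 2) - (1 - α) / 2 * C * R := by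
    have := Real.rpow_lt_rpow (h.fst_pos (by linarith) hsR).le hxs hq
    rwa [← Real.rpow_mul hδ.le, one_div_mul_cancel hq.ne', Real.rpow_one] at this
  have h4 : (1 - α) / 2 * C * s < (1 - α) / 2 * C * R := by
    have : s < R := by exact_mod_cast hsR
    gcongr
  simp only [hz] at h2 h3
  linarith

/-- A lower bound on the slope of the stable manifold bounds the settling time from above. -/
lemma mul_time_lt_rpow_fst (hΛ : 0 < Λ) (hα1 : α < 1) {R k : ℝ}
    (h : IsTrajectoryToOrigin Λ α c m (R : EReal) γ)
    (hb : ∀ t : ℝ, 0 ≤ t → (t : EReal) < R → k ^ 2 * (γ t).1 ^ (1 + α) < (γ t).2 ^ 2) :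
    (1 - α) / 2 * k * R < m.1 ^ ((1 - α) / 2) := by
  set z : ℝ → ℝ := fun t => -(γ t).1 ^ ((1 - α) / 2) + (-((1 - α) / 2 * k)) * t with hz
  have hq : 0 < (1 - α) / 2 := by linarith
  have hmono : ∀ a b : ℝ, 0 ≤ a → a < b → (b : EReal) < R → z a < z b := by
    intro a b ha hab hbR
    refine lt_of_hasDerivWithinAt_pos ha hab (fun t ht =>
      (h.hasDeriv_rpow_fst (ha.trans ht.1) (EReal.coe_lt_of_le ht.2 hbR)).neg.add
        ((hasDerivWithinAt_id t (Ici 0)).const_mul (-((1 - α) / 2 * k)))) fun t ht => ?_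
    have ht0 := ha.trans ht.1.le
    have htR := EReal.coe_lt_of_le ht.2.le hbR
    have hx := h.fst_pos ht0 htR
    have hp : 0 < (γ t).1 ^ ((1 + α) / 2) := Real.rpow_pos_of_pos hx _
    have h1 : k * (γ t).1 ^ ((1 + α) / 2) < -(γ t).2 := by
      refine lt_of_pow_lt_pow_left₀ 2 (by linarith [h.snd_neg hΛ ht0 htR]) ?_
      rw [mul_pow, ← Real.rpow_mul_natCast hx.le]
      simpa using hb t ht0 htR
    rw [Real.rpow_neg hx.le, ← div_eq_mul_inv]
    have h2 : (γ t).2 / (γ t).1 ^ ((1 + α) / 2) < -k := by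
      rw [div_lt_iff₀ hp]; linarith
    nlinarith
  have hR : (0 : ℝ) < R := EReal.coe_pos.1 h.pos
  have h1 : z 0 < z (R / 2) := hmono 0 (R / 2) le_rfl (by positivity)
    (by exact_mod_cast half_lt_self hR)
  have hz0 : z 0 = -m.1 ^ ((1 - α) / 2) := by simp [hz, h.init]
  rw [hz0] at h1
  by_contra hcon
  push Not at hcon
  have hδ : 0 < z (R / 2) + (1 - α) / 2 * k * R := by linarith
  have hlim : Tendsto (fun s : ℝ => (-((1 - α) / 2 * k)) * s) (𝓝 R) (𝓝 (-((1 - α) / 2 * k) * R)) :=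
    tendsto_id.const_mul _
  have hev : ∀ᶠ s in 𝓝[<] R, (-((1 - α) / 2 * k)) * s < z (R / 2) :=
    (hlim.mono_left nhdsWithin_le_nhds).eventually (gt_mem_nhds (by linarith))
  obtain ⟨s, hs, hs1, hs2⟩ := (hev.and (Ioo_mem_nhdsLT (half_lt_self hR))).exists
  have h2 : z (R / 2) < z s := hmono _ s (by positivity) hs1 (by exact_mod_cast hs2)
  have h3 := Real.rpow_pos_of_pos (h.fst_pos (t := s) (by linarith) (by exact_mod_cast hs2)) ((1 - α) / 2)
  simp only [hz] at h2 hs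
  linarith

end IsTrajectoryToOrigin

/-! ### Uniqueness of the trajectory and of the settling time -/

lemma exists_lipschitzOnWith_rpow {α δ : ℝ} (hα : 0 ≤ α) (hα1 : α < 1) (hδ : 0 < δ) :
    ∃ K : NNReal, LipschitzOnWith K (fun x : ℝ => x ^ α) (Ici δ) := by
  refine ⟨(α * δ ^ (α - 1)).toNNReal, Convex.lipschitzOnWith_of_nnnorm_hasDerivWithin_le
    (f' := fun x => α * x ^ (α - 1)) (convex_Ici δ) (fun x hx => ?_) (fun x hx => ?_)⟩
  · exact (Real.hasDerivAt_rpow_const (.inl (hδ.trans_le hx).ne')).hasDerivWithinAt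
  · have hx0 : 0 < x := hδ.trans_le hx
    rw [← NNReal.coe_le_coe, coe_nnnorm, Real.norm_of_nonneg (by positivity),
      Real.coe_toNNReal _ (by positivity)]
    exact mul_le_mul_of_nonneg_left
      (Real.rpow_le_rpow_of_nonpos hδ hx (by linarith)) hα

lemma exists_lipschitzOnWith_fieldX {Λ α c δ : ℝ} (hα : 0 ≤ α) (hα1 : α < 1) (hδ : 0 < δ) :
    ∃ K : NNReal, LipschitzOnWith K (fieldX Λ α c) {p | δ ≤ p.1} := by
  obtain ⟨K, hK⟩ := exists_lipschitzOnWith_rpow hα hα1 hδ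
  have h1 : LipschitzOnWith 1 (fun p : ℝ × ℝ => p.2) {p | δ ≤ p.1} :=
    LipschitzWith.prod_snd.lipschitzOnWith
  have h2 : LipschitzOnWith (K * 1) (fun p : ℝ × ℝ => p.1 ^ α) {p | δ ≤ p.1} :=
    hK.comp (LipschitzWith.prod_fst.lipschitzOnWith) fun p hp => hp
  have h3 : LipschitzOnWith (‖Λ⁻¹‖₊ * (‖c‖₊ * 1 + K * 1))
      (fun p : ℝ × ℝ => Λ⁻¹ * (c * p.2 + p.1 ^ α)) {p | δ ≤ p.1} :=
    (lipschitzWith_smul Λ⁻¹).comp_lipschitzOnWith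
      (((lipschitzWith_smul c).comp_lipschitzOnWith h1).add h2)
  have h4 : fieldX Λ α c = fun p => (p.2, Λ⁻¹ * (c * p.2 + p.1 ^ α)) := by
    funext p
    simp only [fieldX, div_eq_inv_mul]
  rw [h4]
  exact ⟨_, h1.prodMk h3⟩

namespace IsTrajectoryToOrigin

variable {Λ α c : ℝ} {m : ℝ × ℝ} {τ τ' : EReal} {γ γ' : ℝ → ℝ × ℝ}

/-- Since x decreases, up to time T both trajectories stay in x ≥ δ, where δ is the smaller of their
abscissae at T; there the field is Lipschitz. -/
lemma eq_of_lt (hΛ : 0 < Λ) (hα : 0 ≤ α) (hα1 : α < 1)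
    (h : IsTrajectoryToOrigin Λ α c m τ γ) (h' : IsTrajectoryToOrigin Λ α c m τ' γ') {T : ℝ}
    (hT : 0 ≤ T) (hTτ : (T : EReal) < τ) (hTτ' : (T : EReal) < τ') : γ T = γ' T := by
  set δ := min (γ T).1 (γ' T).1
  have hδ : 0 < δ := lt_min (h.fst_pos hT hTτ) (h'.fst_pos hT hTτ')
  obtain ⟨K, hK⟩ := exists_lipschitzOnWith_fieldX (Λ := Λ) (c := c) hα hα1 hδ
  have key : ∀ {σ : EReal} {β : ℝ → ℝ × ℝ}, IsTrajectoryToOrigin Λ α c m σ β → (T : EReal) < σ →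
      ContinuousOn β (Icc 0 T) ∧
      (∀ t ∈ Ico 0 T, HasDerivWithinAt β (fieldX Λ α c (β t)) (Ici t) t) ∧
      ∀ t ∈ Ico 0 T, (β T).1 ≤ (β t).1 := by
    intro σ β hβ hσ
    refine ⟨fun t ht => ?_, fun t ht => ?_, fun t ht => ?_⟩
    · exact (hβ.ode t ht.1 (EReal.coe_lt_of_le ht.2 hσ)).continuousWithinAt.mono fun s hs => hs.1
    · exact (hβ.ode t ht.1 (EReal.coe_lt_of_le ht.2.le hσ)).mono fun s hs => ht.1.trans hs
    · exact (hβ.fst_strictAnti hΛ ht.1 ht.2 hσ).le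
  obtain ⟨a1, a2, a3⟩ := key h hTτ
  obtain ⟨b1, b2, b3⟩ := key h' hTτ'
  exact ODE_solution_unique_of_mem_Icc_right (v := fun _ => fieldX Λ α c)
    (s := fun _ => {p | δ ≤ p.1}) (fun t _ => hK) a1 a2
    (fun t ht => (min_le_left _ _).trans (a3 t ht)) b1 b2
    (fun t ht => (min_le_right _ _).trans (b3 t ht)) (by rw [h.init, h'.init])
    (right_mem_Icc.2 hT)

/-- If τ < τ', the second trajectory still has positive abscissa at τ, while the first falls below
that value before τ. They coincide until then, against the monotonicity of x. -/
lemma time_le (hΛ : 0 < Λ) (hα : 0 ≤ α) (hα1 : α < 1)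
    (h : IsTrajectoryToOrigin Λ α c m τ γ) (h' : IsTrajectoryToOrigin Λ α c m τ' γ') :
    τ' ≤ τ := by
  by_contra hlt
  push Not at hlt
  lift τ to ℝ using ⟨(hlt.trans_le le_top).ne, ((EReal.bot_lt_coe 0).trans h.pos).ne'⟩
  have hτ : 0 < τ := EReal.coe_pos.1 h.pos
  have hx := h'.fst_pos hτ.le hlt
  obtain ⟨s, hs, hsτ, hxs, -⟩ := h.exists_small hx h.pos
  have hs0 : 0 ≤ s := by exact_mod_cast hs
  have hsτ' : s < τ := by exact_mod_cast hsτ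
  rw [h.eq_of_lt hΛ hα hα1 h' hs0 hsτ (hsτ.trans hlt)] at hxs
  exact (h'.fst_strictAnti hΛ hs0 hsτ' hlt).not_gt hxs

lemma time_unique (hΛ : 0 < Λ) (hα : 0 ≤ α) (hα1 : α < 1)
    (h : IsTrajectoryToOrigin Λ α c m τ γ) (h' : IsTrajectoryToOrigin Λ α c m τ' γ') :
    τ' = τ :=
  le_antisymm (h.time_le hΛ hα hα1 h') (h'.time_le hΛ hα hα1 h)

/-! ### The stable manifold as a graph, and uniqueness of the speed -/

/-- The orbit of a trajectory to the origin is the graph of a solution of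
`Λ w w' = x ^ α - c w`. -/
lemma exists_profile (hΛ : 0 < Λ) (hα : 0 ≤ α) (hc : 0 < c)
    (h : IsTrajectoryToOrigin Λ α c m τ γ) :
    ∃ w : ℝ → ℝ, w m.1 = -m.2 ∧ ContinuousOn w (Ioc 0 m.1) ∧ (∀ x ∈ Ioc 0 m.1, 0 < w x) ∧
      (∀ x ∈ Ioo 0 m.1, HasDerivAt w ((x ^ α - c * w x) / (Λ * w x)) x) ∧
      ∀ x ∈ Ioc 0 m.1, w x ^ 2 ≤ 2 / (Λ * (1 + α)) * x ^ (1 + α) := by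
  have hex : ∀ x ∈ Ioc 0 m.1, ∃ t : ℝ, 0 ≤ t ∧ (t : EReal) < τ ∧ (γ t).1 = x := by
    intro x hx
    obtain ⟨s, hs0, hs, hxs, -⟩ := h.exists_small hx.1 h.pos
    have hs0' : 0 ≤ s := by exact_mod_cast hs0
    have hcont : ContinuousOn (fun t => (γ t).1) (Icc 0 s) := fun t ht =>
      (h.hasDeriv_fst ht.1 (EReal.coe_lt_of_le ht.2 hs)).continuousWithinAt.mono fun r hr => hr.1
    obtain ⟨t, ht, htx⟩ := intermediate_value_Icc' hs0' hcont ⟨hxs.le, by simpa [h.init] using hx.2⟩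
    exact ⟨t, ht.1, EReal.coe_lt_of_le ht.2 hs, htx⟩
  choose! g hg0 hgτ hg using hex
  have hanti : ∀ x ∈ Ioc 0 m.1, ∀ t : ℝ, 0 ≤ t → (t : EReal) < τ →
      ((γ t).1 < x → g x < t) ∧ (x < (γ t).1 → t < g x) := by
    intro x hx t ht htτ
    constructor <;> intro hlt <;> by_contra hcon <;> push Not at hcon <;>
      rcases hcon.eq_or_lt with h1 | h1
    · rw [h1, hg x hx] at hlt; exact lt_irrefl _ hlt
    · have := h.fst_strictAnti hΛ ht h1 (hgτ x hx); rw [hg x hx] at this; linarith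
    · rw [← h1, hg x hx] at hlt; exact lt_irrefl _ hlt
    · have := h.fst_strictAnti hΛ (hg0 x hx) h1 htτ; rw [hg x hx] at this; linarith
  have hgm : ∀ x ∈ Ioo 0 m.1, 0 < g x := fun x hx =>
    (hanti x (Ioo_subset_Ioc_self hx) 0 le_rfl h.pos).2 (by simpa [h.init] using hx.2)
  have hm0 : 0 < m.1 := by have := h.fst_pos le_rfl h.pos; rwa [h.init] at this
  have hgm1 : g m.1 = 0 := by
    have hm : m.1 ∈ Ioc 0 m.1 := ⟨hm0, le_rfl⟩
    by_contra hne
    have := h.fst_strictAnti hΛ le_rfl ((hg0 _ hm).lt_of_ne' hne) (hgτ _ hm)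
    rw [hg _ hm, h.init] at this
    exact lt_irrefl _ this
  -- Continuity comes from monotonicity, since x = `m.1` corresponds to t = 0, where only a
  -- one-sided derivative is available.
  have hgcont : ContinuousOn g (Ioc 0 m.1) := by
    intro x hx
    rw [ContinuousWithinAt, tendsto_order]
    constructor
    · intro a ha
      rcases lt_or_ge a 0 with ha0 | ha0
      · filter_upwards [self_mem_nhdsWithin] with y hy using ha0.trans_le (hg0 y hy)
      · have hxa := h.fst_strictAnti hΛ ha0 ha (hgτ x hx)
        rw [hg x hx] at hxa
        filter_upwards [self_mem_nhdsWithin, nhdsWithin_le_nhds (Iio_mem_nhds hxa)] with y hy hy'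
        exact (hanti y hy a ha0 (EReal.coe_lt_of_le ha.le (hgτ x hx))).2 hy'
    · intro b hb
      obtain ⟨b', hb', hb'τ⟩ := EReal.exists_coe_lt (hgτ x hx)
      have h1 : g x < min b b' := lt_min hb hb'
      have h2 : ((min b b' : ℝ) : EReal) < τ := EReal.coe_lt_of_le (min_le_right _ _) hb'τ
      have hxa := h.fst_strictAnti hΛ (hg0 x hx) h1 h2
      rw [hg x hx] at hxa
      filter_upwards [self_mem_nhdsWithin, nhdsWithin_le_nhds (Ioi_mem_nhds hxa)] with y hy hy'
      exact ((hanti y hy _ ((hg0 x hx).trans h1.le) h2).1 hy').trans_le (min_le_left _ _)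
  have hwpos : ∀ x ∈ Ioc 0 m.1, 0 < -(γ (g x)).2 := fun x hx =>
    neg_pos.2 (h.snd_neg hΛ (hg0 x hx) (hgτ x hx))
  refine ⟨fun x => -(γ (g x)).2, by simp only [hgm1, h.init], ?_, hwpos, ?_, ?_⟩
  · intro x hx
    have h1 : ContinuousWithinAt (fun t => (γ t).2) (Ici 0) (g x) :=
      (h.hasDeriv_snd (hg0 x hx) (hgτ x hx)).continuousWithinAt
    exact (ContinuousWithinAt.comp (t := Ici 0) h1 (hgcont x hx) hg0).neg
  · intro x hx
    have hx' := Ioo_subset_Ioc_self hx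
    have hnhds : Ici (0:ℝ) ∈ 𝓝 (g x) := Ici_mem_nhds (hgm x hx)
    have hy := hwpos x hx'
    have hdg : HasDerivAt g ((γ (g x)).2)⁻¹ x := by
      refine HasDerivAt.of_local_left_inverse (f := fun t => (γ t).1)
        (hgcont.continuousAt (Ioc_mem_nhds hx.1 hx.2))
        ((h.hasDeriv_fst (hg0 x hx') (hgτ x hx')).hasDerivAt hnhds) (by linarith) ?_
      filter_upwards [Ioc_mem_nhds hx.1 hx.2] with y hy using hg y hy
    refine (((h.hasDeriv_snd (hg0 x hx') (hgτ x hx')).hasDerivAt hnhds).comp x hdg).neg.congr_deriv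
      ?_
    rw [hg x hx']
    have : (γ (g x)).2 ≠ 0 := by linarith
    field_simp
    ring
  · intro x hx
    have := h.sq_snd_lt hΛ hα hc (hg0 x hx) (hgτ x hx)
    rw [hg x hx] at this
    simpa using this.le

lemma speed_pos {v₀ : ℝ} (hΛ : 0 < Λ) (hc : 0 ≤ c)
    (h : IsTrajectoryToOrigin Λ α c (initialPoint Λ c v₀) τ γ) : 0 < c := by
  refine hc.lt_of_ne fun h0 => ?_
  have := h.snd_neg hΛ le_rfl h.pos
  rw [h.init, ← h0] at this
  simp [initialPoint] at this

/-- The stable manifold is lowered by an increase of the speed. -/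
lemma snd_le_of_speed_lt {c' : ℝ} {m' : ℝ × ℝ} (hΛ : 0 < Λ) (hα : 0 ≤ α) (hc : 0 < c)
    (hcc' : c < c') (hm : m.1 = m'.1)
    (h : IsTrajectoryToOrigin Λ α c m τ γ) (h' : IsTrajectoryToOrigin Λ α c' m' τ' γ') :
    m.2 ≤ m'.2 := by
  obtain ⟨w, hwm, hwc, hw0, hwd, -⟩ := h.exists_profile hΛ hα hc
  obtain ⟨u, hum, huc, hu0, hud, hu2⟩ := h'.exists_profile hΛ hα (hc.trans hcc')
  rw [← hm] at hum huc hu0 hud hu2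
  have hm0 : 0 < m.1 := by have := h.fst_pos le_rfl h.pos; rwa [h.init] at this
  by_contra hcon
  push Not at hcon
  set D : ℝ → ℝ := fun x => w x ^ 2 - u x ^ 2 with hD
  have hDc : ContinuousOn D (Ioc 0 m.1) := (hwc.pow 2).sub (huc.pow 2)
  have hmm : m.1 ∈ Ioc 0 m.1 := ⟨hm0, le_rfl⟩
  have hDm : D m.1 < 0 := by
    have := hw0 _ hmm
    simp only [hD, sub_neg]
    exact pow_lt_pow_left₀ (by linarith) this.le two_ne_zero
  obtain ⟨b, hDb, hb⟩ : ∃ b, D b < 0 ∧ b ∈ Ioo 0 m.1 := by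
    have h1 : ∀ᶠ x in 𝓝[<] m.1, x ∈ Ioo 0 m.1 := Ioo_mem_nhdsLT hm0
    have h2 : Tendsto D (𝓝[<] m.1) (𝓝 (D m.1)) :=
      (hDc _ hmm).mono_left (nhdsWithin_le_iff.2 (h1.mono fun x hx => Ioo_subset_Ioc_self hx))
    exact ((h2.eventually (gt_mem_nhds hDm)).and h1).exists
  -- In x, D' = 2 (c' u - c w) / Λ, which is positive wherever D < 0, that is w < u. Hence D stays
  -- below D b towards x = 0; the reflection s ↦ -s turns this leftward motion into a forward one.
  have hsub : ∀ a ∈ Ioo 0 b, D a ≤ D b := by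
    intro a ha
    have hmem : ∀ s ∈ Icc (-b) (-a), -s ∈ Ioo 0 m.1 := fun s hs =>
      ⟨by linarith [hs.2, ha.1], by linarith [hs.1, hb.2]⟩
    have hd : ∀ s ∈ Icc (-b) (-a), HasDerivAt (fun s => D (-s))
        (2 * (c * w (-s) - c' * u (-s)) / Λ) s := by
      intro s hs
      have hs' := hmem s hs
      have hw := hw0 _ (Ioo_subset_Ioc_self hs')
      have hu := hu0 _ (Ioo_subset_Ioc_self hs')
      have hDd : HasDerivAt D _ (-s) := ((hwd _ hs').pow 2).sub ((hud _ hs').pow 2)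
      refine (hDd.comp s (hasDerivAt_neg s)).congr_deriv ?_
      field_simp
      ring
    have := le_of_hasDerivWithinAt_neg_of_neg (f := fun s => D (-s))
      (f' := fun s => 2 * (c * w (-s) - c' * u (-s)) / Λ) (a := -b) (b := -a)
      (by linarith [ha.2]) (fun s hs => (hd s hs).continuousAt.continuousWithinAt)
      (fun s hs => (hd s (Ico_subset_Icc_self hs)).hasDerivWithinAt)
      (fun s hs hneg => by
        have hs' := Ioo_subset_Ioc_self (hmem s (Ico_subset_Icc_self hs))
        have hw := hw0 _ hs'
        have hu := hu0 _ hs'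
        have hwu : w (-s) < u (-s) := by
          simp only [hD, sub_neg] at hneg
          exact lt_of_pow_lt_pow_left₀ 2 hu.le hneg
        have : c * w (-s) < c' * u (-s) := by nlinarith
        exact div_neg_of_neg_of_pos (by linarith) hΛ) (by simpa using hDb)
    simpa using this
  set C := 2 / (Λ * (1 + α)) with hC
  have hC0 : 0 < C := by positivity
  -- At this a the bound on u gives u a ^ 2 ≤ C a ≤ -D b / 2, which contradicts D a ≤ D b < 0.
  set a := min (b / 2) (min 1 (-D b / (2 * C))) with ha
  have hDb' : 0 < -D b := neg_pos.2 hDb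
  have hb0 : 0 < b := hb.1
  have ha0 : 0 < a := by positivity
  have hab : a ≤ b / 2 := min_le_left _ _
  have ha1 : a ≤ 1 := (min_le_right _ _).trans (min_le_left _ _)
  have haD : a ≤ -D b / (2 * C) := (min_le_right _ _).trans (min_le_right _ _)
  have h1 := hsub a ⟨ha0, by linarith⟩
  have h2 := hu2 a ⟨ha0, by linarith [hb.2]⟩
  have h3 : a ^ (1 + α) ≤ a := by
    simpa using Real.rpow_le_rpow_of_exponent_ge ha0 ha1 (by linarith : (1:ℝ) ≤ 1 + α)
  have h4 : C * a ^ (1 + α) ≤ C * a := by gcongr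
  rw [le_div_iff₀ (by positivity)] at haD
  have h5 : -u a ^ 2 ≤ D a := by simp only [hD]; linarith [sq_nonneg (w a)]
  linarith

/-- A larger speed strictly lowers the initial point, but cannot lower the ordinate of the stable
manifold above v₀. -/
lemma speed_le {c' v₀ : ℝ} (hΛ : 0 < Λ) (hα : 0 ≤ α) (hv₀ : v₀ < 1) (hc : 0 < c)
    (h : IsTrajectoryToOrigin Λ α c (initialPoint Λ c v₀) τ γ)
    (h' : IsTrajectoryToOrigin Λ α c' (initialPoint Λ c' v₀) τ' γ') : c' ≤ c := by
  by_contra hlt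
  push Not at hlt
  have := snd_le_of_speed_lt (m := initialPoint Λ c v₀) (m' := initialPoint Λ c' v₀) hΛ hα hc hlt
    rfl h h'
  simp only [initialPoint] at this
  have h1 : c / Λ < c' / Λ := by gcongr
  nlinarith

end IsTrajectoryToOrigin

/-! ### The Volterra equation for the orbit leaving the origin -/

open MeasureTheory intervalIntegral

/-- The Volterra operator whose fixed points `X` solve `Λ X'' + X' = X ^ α`,
`X 0 = X' 0 = 0` on `[0, ∞)`. -/
noncomputable def volterra (Λ α : ℝ) (f : ℝ → ℝ) (s : ℝ) : ℝ :=
  ∫ r in (0 : ℝ)..max s 0, (1 - Real.exp ((r - max s 0) / Λ)) * f r ^ α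

lemma volterra_kernel_nonneg {Λ r s : ℝ} (hΛ : 0 < Λ) (hr : r ≤ s) :
    0 ≤ 1 - Real.exp ((r - s) / Λ) := by
  rw [sub_nonneg, Real.exp_le_one_iff]
  exact div_nonpos_of_nonpos_of_nonneg (by linarith) hΛ.le

lemma volterra_kernel_le_one {Λ r s : ℝ} : 1 - Real.exp ((r - s) / Λ) ≤ 1 := by
  linarith [Real.exp_pos ((r - s) / Λ)]

lemma intervalIntegrable_volterra {Λ α : ℝ} {f : ℝ → ℝ} {a b s : ℝ}
    (hf : IntervalIntegrable (fun r => f r ^ α) volume a b) :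
    IntervalIntegrable (fun r => (1 - Real.exp ((r - s) / Λ)) * f r ^ α) volume a b :=
  hf.continuousOn_mul (by fun_prop)

/-- Separating the variables of the kernel leaves s only in the endpoints and in a factor, so that
continuity and derivatives in s follow from those of primitives. -/
lemma volterra_eq {Λ α : ℝ} {f : ℝ → ℝ} {s : ℝ}
    (hf : IntervalIntegrable (fun r => f r ^ α) volume 0 (max s 0)) :
    volterra Λ α f s = (∫ r in (0 : ℝ)..max s 0, f r ^ α) -
      Real.exp (-(max s 0) / Λ) * ∫ r in (0 : ℝ)..max s 0, Real.exp (r / Λ) * f r ^ α := by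
  rw [volterra, ← intervalIntegral.integral_const_mul, ← intervalIntegral.integral_sub hf
    ((hf.continuousOn_mul (by fun_prop)).const_mul _)]
  refine intervalIntegral.integral_congr fun r _ => ?_
  rw [sub_div, sub_eq_add_neg (r / Λ), Real.exp_add, neg_div]
  ring

lemma continuous_volterra {Λ α : ℝ} {f : ℝ → ℝ}
    (hf : ∀ a b, IntervalIntegrable (fun r => f r ^ α) volume a b) :
    Continuous (volterra Λ α f) := by
  have h1 : Continuous fun s => ∫ r in (0 : ℝ)..s, f r ^ α := continuous_primitive hf 0
  have h2 : Continuous fun s => ∫ r in (0 : ℝ)..s, Real.exp (r / Λ) * f r ^ α :=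
    continuous_primitive (fun a b => (hf a b).continuousOn_mul (by fun_prop)) 0
  have h3 : Continuous fun s : ℝ => max s 0 := by fun_prop
  rw [show volterra Λ α f = _ from funext fun s => volterra_eq (hf 0 (max s 0))]
  exact (h1.comp h3).sub ((by fun_prop : Continuous fun s : ℝ => Real.exp (-(max s 0) / Λ)).mul
    (h2.comp h3))

lemma continuous_intervalIntegrable_rpow {α : ℝ} (hα : 0 ≤ α) {f : ℝ → ℝ} (hf : Continuous f)
    (a b : ℝ) : IntervalIntegrable (fun r => f r ^ α) volume a b :=
  (hf.rpow_const fun _ => .inr hα).intervalIntegrable a b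

lemma volterra_nonneg {Λ α : ℝ} (hΛ : 0 < Λ) {f : ℝ → ℝ} (hf : ∀ r, 0 ≤ f r) (s : ℝ) :
    0 ≤ volterra Λ α f s :=
  integral_nonneg (le_max_right _ _) fun r hr =>
    mul_nonneg (volterra_kernel_nonneg hΛ hr.2) (Real.rpow_nonneg (hf r) α)

lemma volterra_mono {Λ α : ℝ} (hΛ : 0 < Λ) (hα : 0 ≤ α) {f g : ℝ → ℝ} (hf : Continuous f)
    (hg : Continuous g) (hf0 : ∀ r, 0 ≤ f r) {s : ℝ} (hfg : ∀ r ∈ Icc 0 (max s 0), f r ≤ g r) :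
    volterra Λ α f s ≤ volterra Λ α g s := by
  refine integral_mono_on (le_max_right _ _)
    (intervalIntegrable_volterra (continuous_intervalIntegrable_rpow hα hf _ _))
    (intervalIntegrable_volterra (continuous_intervalIntegrable_rpow hα hg _ _)) fun r hr => ?_
  exact mul_le_mul_of_nonneg_left (Real.rpow_le_rpow (hf0 r) (hfg r hr) hα)
    (volterra_kernel_nonneg hΛ hr.2)

/-- The function `C s ^ (2 / (1 - α))` for `s ≥ 0`, extended by zero. -/
noncomputable def powerBarrier (α C s : ℝ) : ℝ := C * (max s 0) ^ (2 / (1 - α))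

section powerBarrier

variable {Λ α C : ℝ}

lemma powerBarrier_nonneg (hC : 0 ≤ C) (s : ℝ) : 0 ≤ powerBarrier α C s :=
  mul_nonneg hC (Real.rpow_nonneg (le_max_right _ _) _)

lemma continuous_powerBarrier (hα1 : α < 1) : Continuous (powerBarrier α C) := by
  have : 0 < 1 - α := by linarith
  exact continuous_const.mul ((by fun_prop : Continuous fun s : ℝ => max s 0).rpow_const
    fun _ => .inr (by positivity))

lemma powerBarrier_rpow (hα1 : α < 1) (hC : 0 ≤ C) {r : ℝ} (hr : 0 ≤ r) :
    powerBarrier α C r ^ α = C ^ α * r ^ (2 / (1 - α) - 2) := by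
  have : 1 - α ≠ 0 := by linarith
  rw [powerBarrier, max_eq_left hr, Real.mul_rpow hC (by positivity), ← Real.rpow_mul hr]
  congr 2
  field_simp
  ring

lemma two_le_exponent (hα : 0 ≤ α) (hα1 : α < 1) : 2 ≤ 2 / (1 - α) := by
  rw [le_div_iff₀ (by linarith)]; linarith

/-- The value k^(1/(1-α)) is the coefficient for which a power barrier reproduces itself when the
operator contributes the factor k. -/
lemma rpow_one_div_mul (hα1 : α < 1) {k : ℝ} (hk : 0 < k) :
    k * (k ^ (1 / (1 - α))) ^ α = k ^ (1 / (1 - α)) := by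
  have : 1 - α ≠ 0 := by linarith
  nth_rewrite 1 [← Real.rpow_one k]
  rw [← Real.rpow_mul hk.le, ← Real.rpow_add hk]
  congr 1
  field_simp
  ring

/-- Supersolution: the kernel is at most s/Λ and r^(m-2) ≤ s^(m-2) for m = 2/(1-α), which gives K^α
s^m / Λ = K s^m. -/
lemma volterra_powerBarrier_le (hΛ : 0 < Λ) (hα : 0 ≤ α) (hα1 : α < 1) (s : ℝ) :
    volterra Λ α (powerBarrier α ((1 / Λ) ^ (1 / (1 - α)))) s ≤
      powerBarrier α ((1 / Λ) ^ (1 / (1 - α))) s := by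
  have hK : 0 < (1 / Λ) ^ (1 / (1 - α)) := Real.rpow_pos_of_pos (by positivity) _
  have hKK := rpow_one_div_mul hα1 (by positivity : 0 < 1 / Λ)
  set K := (1 / Λ) ^ (1 / (1 - α)) with hKdef
  have hm := two_le_exponent hα hα1
  set x := max s 0 with hx
  have hx0 : 0 ≤ x := le_max_right _ _
  have h1 : volterra Λ α (powerBarrier α K) s ≤
      ∫ r in (0 : ℝ)..x, x / Λ * (K ^ α * x ^ (2 / (1 - α) - 2)) := by
    refine integral_mono_on hx0 (intervalIntegrable_volterra
      (continuous_intervalIntegrable_rpow hα (continuous_powerBarrier hα1) _ _))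
      (by simp) fun r hr => ?_
    have h2 : 1 - Real.exp ((r - x) / Λ) ≤ x / Λ := by
      have := Real.add_one_le_exp ((r - x) / Λ)
      have h3 : 0 ≤ r / Λ := div_nonneg hr.1 hΛ.le
      rw [sub_div] at this ⊢
      linarith
    rw [powerBarrier_rpow hα1 hK.le hr.1]
    have h4 : r ^ (2 / (1 - α) - 2) ≤ x ^ (2 / (1 - α) - 2) :=
      Real.rpow_le_rpow hr.1 hr.2 (by linarith)
    have h5 := Real.rpow_nonneg hr.1 (2 / (1 - α) - 2)
    gcongr
  refine h1.trans (le_of_eq ?_)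
  rw [intervalIntegral.integral_const, smul_eq_mul, powerBarrier, ← hx, sub_zero]
  rcases hx0.eq_or_lt with h0 | h0
  · rw [← h0, Real.zero_rpow (x := 2 / (1 - α)) (by linarith)]; simp
  · rw [Real.rpow_sub h0, Real.rpow_two]
    nth_rewrite 2 [← hKK]
    field_simp

/-- Subsolution on [0, T]: there the kernel is at least κ (s - r) with κ = exp(-T/Λ)/Λ, and the
integral of (s - r) r^(m-2) over [0, s] is s^m / (m (m-1)); ε solves ε = κ ε^α / (m (m-1)). -/
lemma powerBarrier_le_volterra (hΛ : 0 < Λ) (hα : 0 ≤ α) (hα1 : α < 1) {T : ℝ} (hT : 0 < T) :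
    ∃ ε, 0 < ε ∧ ε ≤ (1 / Λ) ^ (1 / (1 - α)) ∧ ∀ s ∈ Icc 0 T,
      powerBarrier α ε s ≤ volterra Λ α (powerBarrier α ε) s := by
  have hm := two_le_exponent hα hα1
  set m := 2 / (1 - α) with hmdef
  set κ := Real.exp (-T / Λ) / Λ with hκ
  have hκ0 : 0 < κ := by positivity
  have hmm : 0 < m * (m - 1) := by nlinarith
  have hk0 : 0 < κ / (m * (m - 1)) := by positivity
  have hε0 : 0 < (κ / (m * (m - 1))) ^ (1 / (1 - α)) := Real.rpow_pos_of_pos hk0 _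
  have hεε := rpow_one_div_mul hα1 hk0
  have h1α : 0 < 1 - α := by linarith
  refine ⟨_, hε0, Real.rpow_le_rpow hk0.le ?_ (by positivity), fun s hs => ?_⟩
  · have h1 : κ ≤ 1 / Λ := by
      rw [hκ]
      gcongr
      rw [Real.exp_le_one_iff]
      exact div_nonpos_of_nonpos_of_nonneg (by linarith) hΛ.le
    refine (div_le_self hκ0.le ?_).trans h1
    nlinarith
  set ε := (κ / (m * (m - 1))) ^ (1 / (1 - α))
  have hint : ∫ r in (0 : ℝ)..s, κ * ε ^ α * (s * r ^ (m - 2) - r ^ (m - 1)) =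
      powerBarrier α ε s := by
    rw [intervalIntegral.integral_const_mul, intervalIntegral.integral_sub
      ((intervalIntegrable_rpow' (by linarith)).const_mul _)
      (intervalIntegrable_rpow' (by linarith)), intervalIntegral.integral_const_mul,
      integral_rpow (.inl (by linarith)), integral_rpow (.inl (by linarith)), powerBarrier,
      max_eq_left hs.1, Real.zero_rpow (by linarith), Real.zero_rpow (by linarith), ← hmdef,
      show m - 2 + 1 = m - 1 by ring, show m - 1 + 1 = m by ring]
    have h2 : s ^ m = s ^ (m - 1) * s := by
      have := Real.rpow_add_one' hs.1 (y := m - 1) (by linarith)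
      rwa [sub_add_cancel] at this
    rw [h2]
    nth_rewrite 2 [← hεε]
    have : m - 1 ≠ 0 := by linarith
    have : m ≠ 0 := by linarith
    field_simp
    ring
  rw [← hint, volterra, max_eq_left hs.1]
  refine integral_mono_on hs.1 ?_ (intervalIntegrable_volterra
      (continuous_intervalIntegrable_rpow hα (continuous_powerBarrier hα1) _ _)) fun r hr => ?_
  · exact (((intervalIntegrable_rpow' (by linarith)).const_mul _).sub
      (intervalIntegrable_rpow' (by linarith))).const_mul _
  · rw [powerBarrier_rpow hα1 hε0.le hr.1, ← hmdef]
    have h2 : r ^ (m - 1) = r ^ (m - 2) * r := by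
      have := Real.rpow_add_one' hr.1 (y := m - 2) (by linarith)
      rwa [show m - 2 + 1 = m - 1 by ring] at this
    have h3 : κ * (s - r) ≤ 1 - Real.exp ((r - s) / Λ) := by
      have h4 : (s - r) / Λ + 1 ≤ Real.exp ((s - r) / Λ) := Real.add_one_le_exp _
      have h5 : Real.exp (-T / Λ) ≤ Real.exp ((r - s) / Λ) := by
        rw [Real.exp_le_exp]
        gcongr
        linarith [hr.1, hs.2]
      have h6 : Real.exp ((r - s) / Λ) * Real.exp ((s - r) / Λ) = 1 := by
        rw [← Real.exp_add, ← add_div]; simp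
      have h7 : 0 ≤ (s - r) / Λ := div_nonneg (by linarith [hr.2]) hΛ.le
      have h8 : κ * (s - r) = Real.exp (-T / Λ) * ((s - r) / Λ) := by rw [hκ]; ring
      rw [h8]
      nlinarith [Real.exp_pos ((r - s) / Λ)]
    have h9 := Real.rpow_nonneg hr.1 (m - 2)
    have h10 := Real.rpow_nonneg hε0.le α
    rw [h2]
    calc κ * ε ^ α * (s * r ^ (m - 2) - r ^ (m - 2) * r)
        = κ * (s - r) * (ε ^ α * r ^ (m - 2)) := by ring
      _ ≤ _ := by gcongr

end powerBarrier

/-- The Volterra equation has a solution that is positive on `(0, ∞)`. -/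
lemma exists_volterra_fixedPoint {Λ α : ℝ} (hΛ : 0 < Λ) (hα : 0 ≤ α) (hα1 : α < 1) :
    ∃ X : ℝ → ℝ, Continuous X ∧ (∀ s, volterra Λ α X s = X s) ∧ (∀ s, 0 < s → 0 < X s) ∧
      ∀ s, 0 ≤ X s ∧ X s ≤ powerBarrier α ((1 / Λ) ^ (1 / (1 - α))) s := by
  have hK : 0 < (1 / Λ) ^ (1 / (1 - α)) := Real.rpow_pos_of_pos (by positivity) _
  have hsup := volterra_powerBarrier_le hΛ hα hα1
  have hKcont := continuous_powerBarrier (C := (1 / Λ) ^ (1 / (1 - α))) hα1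
  have hsub := fun T hT => powerBarrier_le_volterra hΛ hα hα1 (T := T) hT
  set K := (1 / Λ) ^ (1 / (1 - α))
  -- Iterating from the supersolution gives a decreasing sequence; the subsolution, which depends on
  -- T, stays below it on [0, T] and keeps the limit positive.
  set u : ℕ → ℝ → ℝ := fun n => (volterra Λ α)^[n] (powerBarrier α K) with hu
  have hsucc : ∀ n, u (n + 1) = volterra Λ α (u n) := fun n => Function.iterate_succ_apply' _ _ _
  have hcont : ∀ n, Continuous (u n) := by
    intro n
    induction n with
    | zero => exact hKcont
    | succ n ih => rw [hsucc]; exact continuous_volterra (continuous_intervalIntegrable_rpow hα ih)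
  have hnonneg : ∀ n s, 0 ≤ u n s := by
    intro n
    induction n with
    | zero => exact powerBarrier_nonneg hK.le
    | succ n ih => rw [hsucc]; exact volterra_nonneg hΛ ih
  have hstep : ∀ n s, u (n + 1) s ≤ u n s := by
    intro n
    induction n with
    | zero => exact hsup
    | succ n ih =>
      intro s
      exact (congrFun (hsucc (n + 1)) s).trans_le ((volterra_mono hΛ hα (hcont _) (hcont _)
        (hnonneg _) fun r _ => ih r).trans_eq (congrFun (hsucc n) s).symm)
  have hanti : ∀ s, Antitone fun n => u n s := fun s => antitone_nat_of_succ_le fun n => hstep n s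
  have hbdd : ∀ s, BddBelow (range fun n => u n s) := fun s => ⟨0, by
    rintro _ ⟨n, rfl⟩; exact hnonneg n s⟩
  set X : ℝ → ℝ := fun s => ⨅ n, u n s with hX
  have hlim : ∀ s, Tendsto (fun n => u n s) atTop (𝓝 (X s)) := fun s =>
    tendsto_atTop_ciInf (hanti s) (hbdd s)
  have hX0 : ∀ s, 0 ≤ X s := fun s => le_ciInf fun n => hnonneg n s
  have hXK : ∀ s, X s ≤ powerBarrier α K s := fun s => ciInf_le (hbdd s) 0
  have hXm : Measurable X := measurable_of_tendsto_metrizable (fun n => (hcont n).measurable)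
    (tendsto_pi_nhds.2 hlim)
  have hXint : ∀ a b, IntervalIntegrable (fun r => X r ^ α) volume a b := fun a b => by
    refine (continuous_intervalIntegrable_rpow hα hKcont a b).mono_fun
      (hXm.pow_const α).aestronglyMeasurable (ae_of_all _ fun r => ?_)
    beta_reduce
    rw [Real.norm_of_nonneg (Real.rpow_nonneg (hX0 r) α),
      Real.norm_of_nonneg (Real.rpow_nonneg ((hX0 r).trans (hXK r)) α)]
    exact Real.rpow_le_rpow (hX0 r) (hXK r) hα
  have hfix : ∀ s, volterra Λ α X s = X s := by
    intro s
    refine tendsto_nhds_unique ?_ ((tendsto_add_atTop_iff_nat 1).2 (hlim s))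
    simp only [hsucc]
    refine tendsto_integral_filter_of_dominated_convergence (fun r => powerBarrier α K r ^ α)
      (.of_forall fun n => ?_) (.of_forall fun n => ae_of_all _ fun r hr => ?_)
      (continuous_intervalIntegrable_rpow hα hKcont _ _) (ae_of_all _ fun r _ => ?_)
    · exact (intervalIntegrable_volterra
        (continuous_intervalIntegrable_rpow hα (hcont n) _ _)).def'.aestronglyMeasurable
    · rw [uIoc_of_le (le_max_right _ _)] at hr
      have h1 := volterra_kernel_nonneg hΛ hr.2
      have h2 := Real.rpow_nonneg (hnonneg n r) α
      rw [Real.norm_of_nonneg (mul_nonneg h1 h2)]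
      calc _ ≤ 1 * u n r ^ α := mul_le_mul_of_nonneg_right volterra_kernel_le_one h2
        _ = u n r ^ α := one_mul _
        _ ≤ _ := Real.rpow_le_rpow (hnonneg n r) (hanti r (Nat.zero_le n)) hα
    · exact ((Real.continuousAt_rpow_const (X r) α (.inr hα)).tendsto.comp (hlim r)).const_mul _
  refine ⟨X, ?_, hfix, fun T hT => ?_, fun s => ⟨hX0 s, hXK s⟩⟩
  · rw [← funext hfix]
    exact continuous_volterra hXint
  · obtain ⟨ε, hε, hεK, hsubε⟩ := hsub T hT
    have hlow : ∀ n, ∀ s ∈ Icc 0 T, powerBarrier α ε s ≤ u n s := by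
      intro n
      induction n with
      | zero =>
        intro s _
        exact mul_le_mul_of_nonneg_right hεK (Real.rpow_nonneg (le_max_right _ _) _)
      | succ n ih =>
        intro s hs
        rw [hsucc]
        refine (hsubε s hs).trans (volterra_mono hΛ hα (continuous_powerBarrier hα1) (hcont n)
          (powerBarrier_nonneg hε.le) fun r hr => ih r ⟨hr.1, hr.2.trans ?_⟩)
        rw [max_eq_left hs.1]; exact hs.2
    refine lt_of_lt_of_le ?_ (le_ciInf fun n => hlow n T ⟨hT.le, le_rfl⟩)
    rw [powerBarrier, max_eq_left hT.le]
    positivity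

/-! ### The unit-speed orbit and its rescaling -/

/-- The orbit leaving the origin at time zero for the time-reversed field with unit speed. -/
lemma exists_reversed_orbit {Λ α : ℝ} (hΛ : 0 < Λ) (hα : 0 ≤ α) (hα1 : α < 1) :
    ∃ X Y : ℝ → ℝ, Continuous X ∧ Continuous Y ∧ X 0 = 0 ∧ Y 0 = 0 ∧ (∀ s, 0 < s → 0 < X s) ∧
      (∀ s, 0 < s → 0 < Y s) ∧ (∀ s, 0 < s → HasDerivAt X (Y s) s) ∧
      (∀ s, 0 < s → HasDerivAt Y ((X s ^ α - Y s) / Λ) s) ∧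
      ∃ C m : ℝ, ∀ s, 0 < s → X s ≤ C * s ^ m := by
  obtain ⟨X, hXc, hfix, hpos, hX⟩ := exists_volterra_fixedPoint hΛ hα hα1
  have hgc : Continuous fun s => X s ^ α := hXc.rpow_const fun _ => .inr hα
  have hec : Continuous fun s => Real.exp (s / Λ) * X s ^ α := by fun_prop
  set G : ℝ → ℝ := fun s => ∫ r in (0 : ℝ)..s, X r ^ α
  set I : ℝ → ℝ := fun s => ∫ r in (0 : ℝ)..s, Real.exp (r / Λ) * X r ^ α
  have hG : ∀ s, HasDerivAt G (X s ^ α) s := fun s => hgc.integral_hasStrictDerivAt 0 s |>.hasDerivAt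
  have hI : ∀ s, HasDerivAt I (Real.exp (s / Λ) * X s ^ α) s := fun s =>
    hec.integral_hasStrictDerivAt 0 s |>.hasDerivAt
  have hE : ∀ s, HasDerivAt (fun s => Real.exp (-s / Λ)) (Real.exp (-s / Λ) * (-1 / Λ)) s :=
    fun s => ((hasDerivAt_neg s).div_const Λ).exp
  have hEE : ∀ s, Real.exp (-s / Λ) * Real.exp (s / Λ) = 1 := fun s => by
    rw [← Real.exp_add, ← add_div]; simp
  set Y : ℝ → ℝ := fun s => Real.exp (-s / Λ) * I s / Λ with hY
  have hYd : ∀ s, HasDerivAt Y ((X s ^ α - Y s) / Λ) s := fun s => by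
    refine (((hE s).mul (hI s)).div_const Λ).congr_deriv ?_
    rw [← mul_assoc, hEE, hY]
    field_simp
    ring
  have hXeq : ∀ s, 0 ≤ s → X s = G s - Real.exp (-s / Λ) * I s := fun s hs => by
    rw [← hfix s, volterra_eq (hgc.intervalIntegrable _ _), max_eq_left hs]
  refine ⟨X, Y, hXc, continuous_iff_continuousAt.2 fun s => (hYd s).continuousAt, ?_, ?_, hpos,
    fun s hs => ?_, fun s hs => ?_, fun s _ => hYd s, (1 / Λ) ^ (1 / (1 - α)), 2 / (1 - α),
    fun s hs => ?_⟩
  · rw [hXeq 0 le_rfl]; simp [G, I]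
  · simp [hY, I]
  · have : 0 < I s := intervalIntegral_pos_of_pos_on (hec.intervalIntegrable _ _) (fun r hr =>
      mul_pos (Real.exp_pos _) (Real.rpow_pos_of_pos (hpos r hr.1) α)) hs
    positivity
  · refine (((hG s).sub ((hE s).mul (hI s))).congr_deriv ?_).congr_of_eventuallyEq ?_
    · rw [← mul_assoc, hEE, hY]
      field_simp
      ring
    · filter_upwards [Ioi_mem_nhds hs] with r hr using hXeq r (le_of_lt hr)
  · have := (hX s).2
    rwa [powerBarrier, max_eq_left hs.le] at this

/-- The logarithmic derivative of a positive function on `(0, ∞)` that vanishes at zero is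
unbounded above. -/
lemma exists_mul_lt_deriv {X Y : ℝ → ℝ} (hXc : Continuous X) (h0 : X 0 = 0)
    (hX : ∀ s, 0 < s → 0 < X s) (hXd : ∀ s, 0 < s → HasDerivAt X (Y s) s) (q : ℝ) :
    ∃ s, 0 < s ∧ q * X s < Y s := by
  by_contra! hcon
  have hd : ∀ s, 0 < s → HasDerivAt (fun s => X s * Real.exp (-q * s))
      ((Y s - q * X s) * Real.exp (-q * s)) s := fun s hs =>
    ((hXd s hs).mul ((hasDerivAt_id s).const_mul (-q)).exp).congr_deriv (by simp only [id]; ring)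
  -- If Y ≤ q X throughout, X exp(-q s) does not increase, yet it starts at 0 and is positive at 1.
  have hanti : AntitoneOn (fun s => X s * Real.exp (-q * s)) (Icc 0 1) := by
    refine antitoneOn_of_deriv_nonpos (convex_Icc 0 1) (by fun_prop) (fun s hs => ?_)
      fun s hs => ?_
    · rw [interior_Icc] at hs
      exact (hd s hs.1).differentiableAt.differentiableWithinAt
    · rw [interior_Icc] at hs
      rw [(hd s hs.1).deriv]
      exact mul_nonpos_of_nonpos_of_nonneg (by linarith [hcon s hs.1]) (Real.exp_pos _).le
  have := hanti ⟨le_rfl, zero_le_one⟩ ⟨zero_le_one, le_rfl⟩ zero_le_one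
  simp only [h0, zero_mul] at this
  exact (mul_pos (hX 1 one_pos) (Real.exp_pos _)).not_ge this

/-- The logarithmic derivative of a function of polynomial growth is not bounded below by a
positive constant. -/
lemma exists_deriv_lt_mul {X Y : ℝ → ℝ} (hXc : Continuous X)
    (hX : ∀ s, 0 < s → 0 < X s) (hXd : ∀ s, 0 < s → HasDerivAt X (Y s) s) {C m : ℝ}
    (hXC : ∀ s, 0 < s → X s ≤ C * s ^ m) {q : ℝ} (hq : 0 < q) :
    ∃ s, 0 < s ∧ Y s < q * X s := by
  by_contra! hcon
  have hd : ∀ s, 0 < s → HasDerivAt (fun s => X s * Real.exp (-q * s))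
      ((Y s - q * X s) * Real.exp (-q * s)) s := fun s hs =>
    ((hXd s hs).mul ((hasDerivAt_id s).const_mul (-q)).exp).congr_deriv (by simp only [id]; ring)
  -- If Y ≥ q X throughout, X grows at least like exp(q s), faster than any power.
  have hmono : MonotoneOn (fun s => X s * Real.exp (-q * s)) (Ici 1) := by
    refine monotoneOn_of_deriv_nonneg (convex_Ici 1) (by fun_prop) (fun s hs => ?_)
      fun s hs => ?_
    · rw [interior_Ici] at hs
      exact (hd s (one_pos.trans hs)).differentiableAt.differentiableWithinAt
    · rw [interior_Ici] at hs
      rw [(hd s (one_pos.trans hs)).deriv]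
      exact mul_nonneg (by linarith [hcon s (one_pos.trans hs)]) (Real.exp_pos _).le
  have ha : 0 < X 1 * Real.exp (-q * 1) := mul_pos (hX 1 one_pos) (Real.exp_pos _)
  set a := X 1 * Real.exp (-q * 1)
  obtain ⟨s, hs, hs1⟩ := ((tendsto_exp_mul_div_rpow_atTop m q hq).eventually_gt_atTop
    (C / a)).and (eventually_ge_atTop 1) |>.exists
  have hs0 : 0 < s := one_pos.trans_le hs1
  have h1 : a ≤ X s * Real.exp (-q * s) := hmono (mem_Ici.2 le_rfl) hs1 hs1
  rw [neg_mul, Real.exp_neg, ← div_eq_mul_inv, le_div_iff₀ (Real.exp_pos _)] at h1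
  rw [div_lt_div_iff₀ ha (by positivity)] at hs
  linarith [hXC s hs0]

lemma exists_deriv_eq_mul {X Y : ℝ → ℝ} (hXc : Continuous X) (hYc : Continuous Y) (h0 : X 0 = 0)
    (hX : ∀ s, 0 < s → 0 < X s) (hXd : ∀ s, 0 < s → HasDerivAt X (Y s) s) {C m : ℝ}
    (hXC : ∀ s, 0 < s → X s ≤ C * s ^ m) {q : ℝ} (hq : 0 < q) :
    ∃ s, 0 < s ∧ Y s = q * X s := by
  obtain ⟨a, ha, ha'⟩ := exists_mul_lt_deriv hXc h0 hX hXd q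
  obtain ⟨b, hb, hb'⟩ := exists_deriv_lt_mul hXc hX hXd hXC hq
  obtain ⟨s, hs, hsq⟩ := isPreconnected_Ioi.intermediate_value (mem_Ioi.2 hb) (mem_Ioi.2 ha)
    (f := fun s => Y s - q * X s) (by fun_prop)
    (show (0 : ℝ) ∈ Icc _ _ from ⟨by linarith, by linarith⟩)
  exact ⟨s, hs, by simp only at hsq; linarith⟩

lemma exists_trajectory_initialPoint {Λ α v₀ : ℝ} (hΛ : 0 < Λ) (hα : 0 ≤ α) (hα1 : α < 1)
    (hv₀ : 0 < v₀) (hv₀' : v₀ < 1) :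
    ∃ c R : ℝ, 0 < c ∧ ∃ γ, IsTrajectoryToOrigin Λ α c (initialPoint Λ c v₀) (R : EReal) γ := by
  obtain ⟨X, Y, hXc, hYc, hX0, hY0, hX, hY, hXd, hYd, C, m, hXC⟩ :=
    exists_reversed_orbit hΛ hα hα1
  -- The scaled orbit has c = ν and |y|/x = ν Y/X, and the initial point requires |y|/x = c (1 - v₀)
  -- / (Λ v₀). So Y/X must be (1 - v₀) / (Λ v₀), whatever ν is.
  obtain ⟨s, hs, hsq⟩ := exists_deriv_eq_mul hXc hYc hX0 hX hXd hXC
    (div_pos (sub_pos.2 hv₀') (mul_pos hΛ hv₀))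
  have hXs := hX s hs
  set l := v₀ / X s with hl
  have hl0 : 0 < l := by positivity
  set ν := l ^ (-((1 - α) / 2)) with hν
  have hν0 : 0 < ν := by positivity
  -- This relation between the scales of space and time is what keeps the form of the equation.
  have hlν : l * ν ^ 2 = l ^ α := by
    rw [hν, ← Real.rpow_mul_natCast hl0.le]
    nth_rewrite 1 [← Real.rpow_one l]
    rw [← Real.rpow_add hl0]
    congr 1
    push_cast
    ring
  set R := s / ν with hR
  have hR0 : 0 < R := by positivity
  set γ : ℝ → ℝ × ℝ := fun t => (l * X (ν * (R - t)), -(l * ν * Y (ν * (R - t)))) with hγ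
  have hpos : ∀ t : ℝ, (t : EReal) < R → 0 < ν * (R - t) := fun t ht =>
    mul_pos hν0 (sub_pos.2 (EReal.coe_lt_coe_iff.1 ht))
  have hsR : ν * (R - 0) = s := by rw [hR]; field_simp; ring
  refine ⟨ν, R, hν0, γ, ⟨EReal.coe_pos.2 hR0, ?_, fun t _ htR => ?_, fun t _ htR => ?_,
    fun t _ htR h0 => ?_, fun U hU => ?_⟩⟩
  · refine Prod.ext ?_ ?_
    · simp only [hγ, hsR, initialPoint, hl]
      field_simp
    · simp only [hγ, hsR, initialPoint, hsq, hl]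
      field_simp
  · have hp := hpos t htR
    have hin : HasDerivAt (fun t => ν * (R - t)) (-ν) t :=
      (((hasDerivAt_id t).const_sub R).const_mul ν).congr_deriv (by ring)
    have h1 : HasDerivAt (fun t => l * X (ν * (R - t))) (-(l * ν * Y (ν * (R - t)))) t :=
      (((hXd _ hp).comp t hin).const_mul l).congr_deriv (by ring)
    have h2 : HasDerivAt (fun t => -(l * ν * Y (ν * (R - t))))
        ((ν * -(l * ν * Y (ν * (R - t))) + (l * X (ν * (R - t))) ^ α) / Λ) t := by
      refine (((hYd _ hp).comp t hin).const_mul (l * ν)).neg.congr_deriv ?_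
      rw [Real.mul_rpow hl0.le (hX _ hp).le, ← hlν]
      ring
    exact (h1.prodMk h2).hasDerivWithinAt
  · have hp := hpos t htR
    have := hX _ hp
    have := hY _ hp
    exact ⟨by simp only [hγ]; positivity, by simp only [hγ, Left.neg_nonpos_iff]; positivity⟩
  · have := hX _ (hpos t htR)
    have h1 : l * X (ν * (R - t)) = 0 := congrArg Prod.fst h0
    exact (by positivity : l * X (ν * (R - t)) ≠ 0) h1
  · have hγc : Continuous γ := by fun_prop
    have hγR : γ R = 0 := by simp [hγ, hX0, hY0]
    have h1 : ∀ᶠ t in 𝓝 R, γ t ∈ U := hγc.continuousAt.eventually_mem (by rwa [hγR])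
    obtain ⟨a, ha, haU⟩ := mem_nhdsLE_iff_exists_Ioc_subset.1 (nhdsWithin_le_nhds h1)
    obtain ⟨b, hb1, hb2⟩ := exists_between (max_lt hR0 (mem_Iio.1 ha))
    exact ⟨b, (le_max_left _ _).trans hb1.le, EReal.coe_lt_coe_iff.2 hb2, fun t hbt htR =>
      haU ⟨((le_max_right _ _).trans_lt hb1).trans_le hbt, (EReal.coe_lt_coe_iff.1 htR).le⟩⟩

/-! ### Explicit bounds and their limits -/

section bounds

variable {Λ α c v₀ R : ℝ} {γ : ℝ → ℝ × ℝ}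

lemma rpow_half_sq {x : ℝ} (hx : 0 ≤ x) : (x ^ (1 / 2 : ℝ)) ^ 2 = x := by
  rw [← Real.sqrt_eq_rpow, Real.sq_sqrt hx]

lemma lowerBoundR_lt_time (hΛ : 0 < Λ) (hα : 0 ≤ α) (hα1 : α < 1) (hc : 0 < c)
    (h : IsTrajectoryToOrigin Λ α c (initialPoint Λ c v₀) (R : EReal) γ) :
    lowerBoundR Λ v₀ α < R := by
  have h1α : 0 < 1 - α := by linarith
  set C := (2 * (1 + α) * Λ) ^ (1 / 2 : ℝ) with hC
  have hC2 : C ^ 2 = 2 * (1 + α) * Λ := rpow_half_sq (by positivity)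
  have hC0 : 0 < C := by positivity
  -- The slope (2/C)² = 2/(Λ(1+α)) is the energy constant.
  have h1 := h.rpow_fst_lt_mul_time hα1 (C := 2 / C) (by positivity) fun t ht htR => by
    have := h.sq_snd_lt hΛ hα hc ht htR
    rw [div_pow, hC2]
    convert this using 2
    field_simp
  rw [lowerBoundR, ← hC]
  calc C / (1 - α) * v₀ ^ ((1 - α) / 2) < C / (1 - α) * ((1 - α) / 2 * (2 / C) * R) := by
        gcongr; exact h1
    _ = R := by field_simp

lemma time_lt_upperBoundR (hΛ : 0 < Λ) (hα : 0 ≤ α) (hα1 : α < 1) (hc : 0 < c) (hv₀ : 0 < v₀)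
    (hv₀' : v₀ < 1) (h : IsTrajectoryToOrigin Λ α c (initialPoint Λ c v₀) (R : EReal) γ) :
    R < upperBoundR Λ v₀ α := by
  have h1α : 0 < 1 - α := by linarith
  have h1v : 0 < 1 - v₀ := by linarith
  set A := Λ ^ (1 / 2 : ℝ) with hA
  set B := (2 : ℝ) ^ (3 / 2 : ℝ) with hB
  set D := (1 + α) ^ (1 / 2 : ℝ) with hD
  have hA2 : A ^ 2 = Λ := rpow_half_sq hΛ.le
  have hD2 : D ^ 2 = 1 + α := rpow_half_sq (by linarith)
  have hB2 : B ^ 2 = 8 := by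
    rw [hB, ← Real.rpow_mul_natCast (by norm_num)]
    norm_num
  have hA0 : 0 < A := by positivity
  have hB0 : 0 < B := by positivity
  have hD0 : 0 < D := by positivity
  -- The slope for which 2 v₀^((1-α)/2) / ((1-α) k) is the claimed upper bound.
  set k := (1 - v₀) * D / (B * A) with hk
  have hk0 : 0 < k := by positivity
  have hk2 : k ^ 2 = (1 - v₀) ^ 2 * (1 + α) / (8 * Λ) := by
    rw [hk, div_pow, mul_pow, mul_pow, hA2, hB2, hD2]
  have hE := h.sq_snd_lt hΛ hα hc le_rfl h.pos
  rw [h.init] at hE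
  simp only [initialPoint] at hE
  have hv : v₀ ^ (1 + α) * v₀ ^ (1 - α) = v₀ ^ 2 := by
    rw [← Real.rpow_add hv₀, ← Real.rpow_two]
    congr 1
    ring
  have hvq : (v₀ ^ ((1 - α) / 2)) ^ 2 = v₀ ^ (1 - α) := by
    rw [← Real.rpow_mul_natCast hv₀.le]
    congr 1
    push_cast
    ring
  -- The factor 1 - v₀ in k meets c in the ordinate of the initial point, where the energy bound
  -- applies.
  have hck : c * k * v₀ ^ ((1 - α) / 2) < v₀ / 2 := by
    refine lt_of_pow_lt_pow_left₀ 2 (by positivity) ?_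
    have hp : 0 < v₀ ^ (1 - α) := Real.rpow_pos_of_pos hv₀ _
    calc (c * k * v₀ ^ ((1 - α) / 2)) ^ 2
        = (-(c / Λ) * (1 - v₀)) ^ 2 * (Λ * (1 + α) / 8 * v₀ ^ (1 - α)) := by
          rw [mul_pow, mul_pow, hvq, hk2]; field_simp
      _ < 2 / (Λ * (1 + α)) * v₀ ^ (1 + α) * (Λ * (1 + α) / 8 * v₀ ^ (1 - α)) := by
          gcongr
      _ = v₀ ^ (1 + α) * v₀ ^ (1 - α) / 4 := by field_simp; norm_num
      _ = (v₀ / 2) ^ 2 := by rw [hv]; ring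
  -- The first term is at most 1/4 and the second is below v₀/2 < 1/2.
  have hkm : k ^ 2 * (1 + α) * Λ / 2 + c * k * v₀ ^ ((1 - α) / 2) < 1 := by
    have h1 : k ^ 2 * (1 + α) * Λ / 2 = ((1 - v₀) * (1 + α)) ^ 2 / 16 := by
      rw [hk2]; field_simp; norm_num
    have h2 : ((1 - v₀) * (1 + α)) ^ 2 ≤ (1 * 2) ^ 2 := by
      gcongr <;> linarith
    rw [h1]
    linarith
  have h1 := h.mul_time_lt_rpow_fst hΛ hα1 (k := k) fun t ht htR =>
    h.lt_sq_snd hΛ hα hα1 hc.le hk0 hkm ht htR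
  have h2 : upperBoundR Λ v₀ α = 2 / ((1 - α) * k) * v₀ ^ ((1 - α) / 2) := by
    rw [upperBoundR, constA, ← hA, ← hB, ← hD, hk]
    field_simp
  rw [h2]
  calc R = 2 / ((1 - α) * k) * ((1 - α) / 2 * k * R) := by field_simp
    _ < _ := by gcongr; exact h1

lemma tendsto_inv_one_sub : Tendsto (fun α : ℝ => (1 - α)⁻¹) (𝓝[<] 1) atTop := by
  refine tendsto_inv_nhdsGT_zero.comp (tendsto_nhdsWithin_iff.2 ⟨?_, ?_⟩)
  · have : Tendsto (fun α : ℝ => 1 - α) (𝓝 1) (𝓝 (1 - 1)) := tendsto_const_nhds.sub tendsto_id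
    rw [sub_self] at this
    exact this.mono_left nhdsWithin_le_nhds
  · filter_upwards [self_mem_nhdsWithin] with α hα using sub_pos.2 (mem_Iio.1 hα)

lemma tendsto_lowerBoundR (hΛ : 0 < Λ) (hv₀ : 0 < v₀) :
    Tendsto (fun α : ℝ => lowerBoundR Λ v₀ α) (𝓝[<] 1) atTop := by
  have hc : ContinuousAt (fun α : ℝ =>
      (2 * (1 + α) * Λ) ^ (1 / 2 : ℝ) * v₀ ^ ((1 - α) / 2)) 1 := by
    refine ContinuousAt.mul (ContinuousAt.rpow_const (by fun_prop) (.inr (by norm_num)))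
      (ContinuousAt.rpow continuousAt_const (by fun_prop) (.inl hv₀.ne'))
  have hpos : 0 < (2 * (1 + 1) * Λ) ^ (1 / 2 : ℝ) * v₀ ^ (((1:ℝ) - 1) / 2) := by positivity
  refine (tendsto_inv_one_sub.atTop_mul_pos hpos
    (hc.tendsto.mono_left nhdsWithin_le_nhds)).congr fun α => ?_
  rw [lowerBoundR]
  ring

lemma tendsto_upperBoundR (hΛ : 0 < Λ) (hv₀ : 0 < v₀) (hv₀' : v₀ < 1) :
    Tendsto (fun α : ℝ => upperBoundR Λ v₀ α) (𝓝[<] 1) atTop := by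
  have h1v : 0 < 1 - v₀ := by linarith
  have hc : ContinuousAt (fun α : ℝ => 2 * Λ ^ (1 / 2 : ℝ) *
      ((2 : ℝ) ^ (3 / 2 : ℝ) / (1 + α) ^ (1 / 2 : ℝ)) * (v₀ ^ ((1 - α) / 2) / (1 - v₀))) 1 := by
    refine (continuousAt_const.mul (continuousAt_const.div
      (ContinuousAt.rpow_const (by fun_prop) (.inr (by norm_num))) (by positivity))).mul
      ((ContinuousAt.rpow continuousAt_const (by fun_prop) (.inl hv₀.ne')).div_const _)
  have hpos : 0 < 2 * Λ ^ (1 / 2 : ℝ) * ((2 : ℝ) ^ (3 / 2 : ℝ) / (1 + 1) ^ (1 / 2 : ℝ)) *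
    (v₀ ^ (((1:ℝ) - 1) / 2) / (1 - v₀)) := by positivity
  refine (tendsto_inv_one_sub.atTop_mul_pos hpos
    (hc.tendsto.mono_left nhdsWithin_le_nhds)).congr fun α => ?_
  rw [upperBoundR, constA]
  ring

end bounds

theorem lemma6p6 (Λ v₀ : ℝ) (hΛ : 0 < Λ) (hv₀ : 0 < v₀) (hv₀' : v₀ < 1) :
    (∀ α : ℝ, 0 ≤ α → α < 1 →
      ∃ c R : ℝ,
        -- `c = c(v₀)` is the unique speed
        (∀ c' : ℝ, IsSpeed Λ α v₀ c' ↔ c' = c) ∧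
        -- `R = R(v₀)` is the settling time; in particular it is finite
        (∀ τ : EReal, IsSettlingTime Λ α c (initialPoint Λ c v₀) τ ↔ τ = (R : EReal)) ∧
        lowerBoundR Λ v₀ α < R ∧ R < upperBoundR Λ v₀ α) ∧
    Tendsto (fun α : ℝ => lowerBoundR Λ v₀ α) (𝓝[<] 1) atTop ∧
    Tendsto (fun α : ℝ => upperBoundR Λ v₀ α) (𝓝[<] 1) atTop := by
  refine ⟨fun α hα hα1 => ?_, tendsto_lowerBoundR hΛ hv₀, tendsto_upperBoundR hΛ hv₀ hv₀'⟩
  obtain ⟨c, R, hc, γ, h⟩ := exists_trajectory_initialPoint hΛ hα hα1 hv₀ hv₀'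
  refine ⟨c, R, fun c' => ⟨?_, ?_⟩, fun τ => ⟨?_, ?_⟩, lowerBoundR_lt_time hΛ hα hα1 hc h,
    time_lt_upperBoundR hΛ hα hα1 hc hv₀ hv₀' h⟩
  · rintro ⟨hc', τ, γ', h'⟩
    exact le_antisymm (h.speed_le hΛ hα hv₀' hc h')
      (h'.speed_le hΛ hα hv₀' (h'.speed_pos hΛ hc') h)
  · rintro rfl
    exact ⟨hc.le, R, γ, h⟩
  · rintro ⟨γ', h'⟩
    exact h.time_unique hΛ hα hα1 h'
  · rintro rfl
    exact ⟨γ, h⟩
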